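/- A multilinear commutator word is a group word obtained from variables by nesting commutators $[u,v]=u^{-1}v^{-1}uv$, always using different variables (a single variable is allowed). Let $w=w(x_1,\dots,x_n)$ be a multilinear commutator word, and let $G$ be a profinite group which is virtually soluble, i.e. has a soluble closed subgroup of finite index. Suppose that every $w$-value $w(g_1,\dots,g_n)$, with $g_1,\dots,g_n\in G$, has finite order. Let $w(G)$ denote the closed subgroup of $G$ generated by all $w$-values. Then $w(G)$ is locally finite, i.e. every closed subgroup of $w(G)$ that is topologically generated by finitely many elements is finite, and $w(G)$ has finite exponent, i.e. there is an integer $e\ge 1$ with $x^e=1$ for all $x\in w(G)$. -/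

import Mathlib

/-- `IsMultilinearCommutatorOn s w`: the group word `w` is obtained by nesting commutators
`[u, v] = u⁻¹ v⁻¹ u v`, starting from variables, and `s` is the set of variables that occur in it.
Disjointness says that always different variables are used. -/
inductive IsMultilinearCommutatorOn {α : Type*} : Set α → FreeGroup α → Prop
  | var (a : α) : IsMultilinearCommutatorOn {a} (FreeGroup.of a)
  | comm {s t : Set α} {u v : FreeGroup α}
      (hu : IsMultilinearCommutatorOn s u) (hv : IsMultilinearCommutatorOn t v)
      (hst : Disjoint s t) :
      IsMultilinearCommutatorOn (s ∪ t) (u⁻¹ * v⁻¹ * u * v)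

/-- A multilinear commutator word (outer commutator word) in the variables `α`. -/
def IsMultilinearCommutator {α : Type*} (w : FreeGroup α) : Prop :=
  ∃ s : Set α, IsMultilinearCommutatorOn s w

/-- The set of `w`-values in `G`: all `w(g₁, …, gₙ)` with `gᵢ ∈ G`. -/
def wordValues {α : Type*} (w : FreeGroup α) (G : Type*) [Group G] : Set G :=
  Set.range fun g : α → G => FreeGroup.lift g w

/-- The (topological) verbal subgroup `w(G)`: the closed subgroup generated by all `w`-values. -/
def verbalSubgroup {α : Type*} (w : FreeGroup α) (G : Type*) [Group G] [TopologicalSpace G]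
    [IsTopologicalGroup G] : Subgroup G :=
  (Subgroup.closure (wordValues w G)).topologicalClosure

/-- A topological group is virtually soluble if it has a soluble closed subgroup of finite index. -/
def IsVirtuallySoluble (G : Type*) [Group G] [TopologicalSpace G] : Prop :=
  ∃ H : Subgroup G, IsClosed (H : Set G) ∧ H.FiniteIndex ∧ Group.IsSolvable H

/-- A topological group is locally finite if every closed subgroup that is topologically generated
by finitely many elements is finite. -/
def IsLocallyFiniteGroup (G : Type*) [Group G] [TopologicalSpace G] [IsTopologicalGroup G] : Prop :=
  ∀ S : Set G, S.Finite → Finite (Subgroup.closure S).topologicalClosure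

/-!
Write `w(A)` for the abstract subgroup generated by the values of `w` whose `i`-th argument lies in
a normal subgroup `A i`. Since `w` is a multilinear commutator, `w(A)` is an iterated commutator of
the `A i`; hence changing an argument modulo a normal subgroup `K` changes the value only by an
element of `w(..., K, ...)` (`IsMultilinearCommutatorOn.inv_lift_mul_lift_update_mem`).

Choose a series `G = H 0 ≥ H 1 ≥ ... ≥ H d = 1` of closed normal subgroups with `G / H 1` finite and
the later factors abelian, and let each `A i` be one of the `H k`. Let `N` be the product of the
subgroups obtained from `w(A)` by replacing one `A i = H k` by `H (k + 1)`. If some `A i` is proper,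
then `w(A) / N` is abelian. The central step
(`IsMultilinearCommutatorOn.exists_pow_mem`) shows that then `w(A) / N` has finite exponent. By
Baire category, every coset of an open subgroup of the product of the `A i` contains a smaller coset
on which the orders of the values are bounded. The formula for `w` at a product `y * k` in one
argument, with `w(A) / N` abelian, moves such a bound from cosets to subgroups. One then allows
more and more arguments to lie outside an open subgroup `M`: values with fewer arguments outside `M`
being already bounded, the next values depend only on the cosets of their arguments
outside `M`, of which there are finitely many. By induction along the series all `w(A)` with some
`A i` proper have finite exponent.

Modulo the product of the `w(G, ..., H 1, ..., G)` there are only finitely many `w`-values. They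
have finite order and form a set closed under conjugation, so by Dietzmann's lemma they generate a
finite group. Thus the abstract verbal subgroup has finite exponent, and so has its closure. Local
finiteness follows, because a finitely generated torsion group with a soluble subgroup of finite
index is finite.
-/

open scoped commutatorElement

/-! ### Values of multilinear commutators on normal subgroups -/

/-- The abstract subgroup generated by the values `w(g)` whose `i`-th argument is taken from the
subgroup `A i`, for every variable `i`. -/
def verbalOn {ι G : Type*} [Group G] (w : FreeGroup ι) (A : ι → Subgroup G) : Subgroup G :=
  Subgroup.closure {x | ∃ g : ι → G, (∀ i, g i ∈ A i) ∧ FreeGroup.lift g w = x}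

section WordValues

variable {ι G : Type*} [Group G]

lemma lift_conj (g : ι → G) (x : G) (w : FreeGroup ι) :
    FreeGroup.lift (fun i => x * g i * x⁻¹) w = x * FreeGroup.lift g w * x⁻¹ := by
  have h : FreeGroup.lift (fun i => x * g i * x⁻¹) =
      (MulAut.conj x).toMonoidHom.comp (FreeGroup.lift g) := by
    ext i; simp
  rw [h]; simp

lemma lift_conj_inv (g : ι → G) (x : G) (w : FreeGroup ι) :
    FreeGroup.lift (fun i => x⁻¹ * g i * x) w = x⁻¹ * FreeGroup.lift g w * x := by
  simpa using lift_conj g x⁻¹ w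

lemma map_lift_apply {H : Type*} [Group H] (f : G →* H) (g : ι → G) (w : FreeGroup ι) :
    f (FreeGroup.lift g w) = FreeGroup.lift (fun i => f (g i)) w := by
  have h : f.comp (FreeGroup.lift g) = FreeGroup.lift (fun i => f (g i)) := by
    ext i; simp
  rw [← h]; simp

lemma lift_mem_verbalOn (w : FreeGroup ι) {A : ι → Subgroup G} {g : ι → G} (hg : ∀ i, g i ∈ A i) :
    FreeGroup.lift g w ∈ verbalOn w A :=
  Subgroup.subset_closure ⟨g, hg, rfl⟩

lemma verbalOn_le {w : FreeGroup ι} {A : ι → Subgroup G} {T : Subgroup G} :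
    verbalOn w A ≤ T ↔ ∀ g : ι → G, (∀ i, g i ∈ A i) → FreeGroup.lift g w ∈ T := by
  rw [verbalOn, Subgroup.closure_le]
  exact ⟨fun h g hg => h ⟨g, hg, rfl⟩, by rintro h _ ⟨g, hg, rfl⟩; exact h g hg⟩

lemma verbalOn_normal (w : FreeGroup ι) {A : ι → Subgroup G} (hA : ∀ i, (A i).Normal) :
    (verbalOn w A).Normal := by
  refine ⟨fun n hn x => ?_⟩
  have : verbalOn w A ≤ (verbalOn w A).comap (MulAut.conj x).toMonoidHom := by
    refine verbalOn_le.2 fun g hg => ?_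
    have := lift_mem_verbalOn w (A := A) (g := fun i => x * g i * x⁻¹)
      (fun i => (hA i).conj_mem _ (hg i) x)
    rw [lift_conj] at this
    simpa using this
  simpa using this hn

end WordValues

namespace IsMultilinearCommutatorOn

variable {ι G : Type*} [Group G] {s : Set ι} {w : FreeGroup ι}

lemma lift_congr (hw : IsMultilinearCommutatorOn s w) {g g' : ι → G} (h : ∀ i ∈ s, g i = g' i) :
    FreeGroup.lift g w = FreeGroup.lift g' w := by
  induction hw with
  | var a => simpa using h
  | comm hu hv hst ihu ihv =>
    simp only [map_mul, map_inv, ihu fun i hi => h i (.inl hi), ihv fun i hi => h i (.inr hi)]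

lemma lift_update_of_notMem [DecidableEq ι] (hw : IsMultilinearCommutatorOn s w) {j : ι}
    (hj : j ∉ s) (g : ι → G) (x : G) :
    FreeGroup.lift (Function.update g j x) w = FreeGroup.lift g w :=
  hw.lift_congr fun _ hi => Function.update_of_ne (by grind) _ _

lemma verbalOn_congr (hw : IsMultilinearCommutatorOn s w) {A B : ι → Subgroup G}
    (h : ∀ i ∈ s, A i = B i) : verbalOn w A = verbalOn w B := by
  classical
  have key : ∀ {A B : ι → Subgroup G}, (∀ i ∈ s, A i = B i) → verbalOn w A ≤ verbalOn w B := by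
    intro A B h
    refine verbalOn_le.2 fun g hg => ?_
    rw [hw.lift_congr (g' := fun i => if i ∈ s then g i else 1) (fun i hi => by simp [hi])]
    refine lift_mem_verbalOn w fun i => ?_
    by_cases hi : i ∈ s
    · simpa [hi, ← h i hi] using hg i
    · simp [hi, one_mem]
  exact le_antisymm (key h) (key fun i hi => (h i hi).symm)

/-- A value of `w` lies in every normal subgroup that contains one of the arguments used by `w`. -/
lemma lift_mem_of_normal (hw : IsMultilinearCommutatorOn s w) {j : ι} (hj : j ∈ s)
    {K : Subgroup G} [hK : K.Normal] {g : ι → G} (hg : g j ∈ K) : FreeGroup.lift g w ∈ K := by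
  induction hw with
  | var a => rcases hj with rfl; simpa using hg
  | @comm s t u v hu hv hst ihu ihv =>
    simp only [map_mul, map_inv]
    rcases hj with hj | hj
    · have h := ihu hj
      have := mul_mem (inv_mem h) (hK.conj_mem _ h (FreeGroup.lift g v)⁻¹)
      simpa [mul_assoc] using this
    · have h := ihv hj
      have := mul_mem (hK.conj_mem _ (inv_mem h) (FreeGroup.lift g u)⁻¹) h
      simpa [mul_assoc] using this

lemma verbalOn_le_of_mem (hw : IsMultilinearCommutatorOn s w) {A : ι → Subgroup G} {j : ι}
    (hj : j ∈ s) (hA : (A j).Normal) : verbalOn w A ≤ A j :=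
  verbalOn_le.2 fun _ hg => hw.lift_mem_of_normal hj (hg j)

/-- The nontrivial inclusion in `w(A) = [u(A), v(A)]` for `w = [u, v]` in disjoint variables: the
values of `u` and of `v` form sets closed under conjugation that commute modulo `w(A)`. -/
lemma commutator_verbalOn_le {t : Set ι} {u v : FreeGroup ι} (hu : IsMultilinearCommutatorOn s u)
    (hv : IsMultilinearCommutatorOn t v) (hst : Disjoint s t) {A : ι → Subgroup G}
    (hA : ∀ i, (A i).Normal) :
    ⁅verbalOn u A, verbalOn v A⁆ ≤ verbalOn (u⁻¹ * v⁻¹ * u * v) A := by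
  classical
  set W := verbalOn (u⁻¹ * v⁻¹ * u * v) A
  have hW : W.Normal := verbalOn_normal _ hA
  -- Modulo `W` every value of `u` commutes with every value of `v`.
  have hcomm : ∀ g h : ι → G, (∀ i, g i ∈ A i) → (∀ i, h i ∈ A i) →
      Commute (QuotientGroup.mk' W (FreeGroup.lift g u))
        (QuotientGroup.mk' W (FreeGroup.lift h v)) := by
    intro g h hg hh
    have hf : ∀ i, (if i ∈ s then g i else h i) ∈ A i := fun i => by
      split_ifs; exacts [hg i, hh i]
    have := lift_mem_verbalOn (u⁻¹ * v⁻¹ * u * v) hf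
    simp only [map_mul, map_inv] at this
    rw [hu.lift_congr (g' := g) (fun i hi => by simp [hi]),
      hv.lift_congr (g' := h) (fun i hi => by simp [hst.notMem_of_mem_right hi])] at this
    have h1 := (QuotientGroup.eq_one_iff (N := W) _).2 this
    simp only [QuotientGroup.mk_mul, QuotientGroup.mk_inv] at h1
    have h2 : ((FreeGroup.lift h v : G) : G ⧸ W) * ((FreeGroup.lift g u : G) : G ⧸ W) *
      ((((FreeGroup.lift g u : G) : G ⧸ W))⁻¹ * (((FreeGroup.lift h v : G) : G ⧸ W))⁻¹ *
        ((FreeGroup.lift g u : G) : G ⧸ W) * ((FreeGroup.lift h v : G) : G ⧸ W)) =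
        ((FreeGroup.lift h v : G) : G ⧸ W) * ((FreeGroup.lift g u : G) : G ⧸ W) := by
      rw [h1, mul_one]
    refine (Commute.symm ?_)
    simpa [Commute, SemiconjBy, mul_assoc, eq_comm] using h2
  rw [Subgroup.commutator_le]
  intro a ha b hb
  have hab : Commute (QuotientGroup.mk' W a) (QuotientGroup.mk' W b) := by
    have h1 : verbalOn u A ≤ (Subgroup.centralizer
        (((verbalOn v A).map (QuotientGroup.mk' W) : Subgroup _) : Set (G ⧸ W))).comap
        (QuotientGroup.mk' W) := by
      refine verbalOn_le.2 fun g hg => ?_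
      rw [Subgroup.mem_comap, Subgroup.mem_centralizer_iff]
      have h2 : verbalOn v A ≤ (Subgroup.centralizer
          {QuotientGroup.mk' W (FreeGroup.lift g u)}).comap (QuotientGroup.mk' W) := by
        refine verbalOn_le.2 fun h hh => ?_
        rw [Subgroup.mem_comap, Subgroup.mem_centralizer_iff]
        rintro _ rfl
        exact hcomm g h hg hh
      rintro _ ⟨y, hy, rfl⟩
      exact (Subgroup.mem_centralizer_iff.1 (h2 hy) _ rfl).symm
    exact (Subgroup.mem_centralizer_iff.1 (h1 ha) _ ⟨b, hb, rfl⟩).symm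
  rw [← QuotientGroup.eq_one_iff, ← QuotientGroup.mk'_apply W, map_commutatorElement]
  exact commutatorElement_eq_one_iff_commute.2 hab

/-- Right multiplication of one argument by an element of a normal subgroup `K` changes the value
by an element of the subgroup generated by the values that take this argument from `K`. -/
lemma inv_lift_mul_lift_update_mem [DecidableEq ι] (hw : IsMultilinearCommutatorOn s w) {j : ι}
    (hj : j ∈ s) {A : ι → Subgroup G} (hA : ∀ i, (A i).Normal) {K : Subgroup G} (hK : K.Normal)
    {g : ι → G} (hg : ∀ i, g i ∈ A i) {k : G} (hk : k ∈ K) :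
    (FreeGroup.lift g w)⁻¹ * FreeGroup.lift (Function.update g j (g j * k)) w ∈
      verbalOn w (Function.update A j K) := by
  have hB : ∀ i, (Function.update A j K i).Normal := fun i => by
    by_cases h : i = j
    · subst h; simpa
    · simpa [h] using hA i
  induction hw with
  | var a =>
    rcases hj with rfl
    refine Subgroup.subset_closure ⟨Function.update g j k, fun i => ?_, by simp⟩
    by_cases h : i = j
    · subst h; simpa
    · simpa [h] using hg i
  | @comm s t u v hu hv hst ihu ihv =>
    simp only [map_mul, map_inv]
    set B := Function.update A j K with hBdef
    refine commutator_verbalOn_le hu hv hst hB ?_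
    have hUn := verbalOn_normal u hB
    have hVn := verbalOn_normal v hB
    rcases hj with hj | hj
    · have hjt : j ∉ t := hst.notMem_of_mem_left hj
      have ihu := ihu hj
      rw [hv.lift_update_of_notMem hjt]
      have hb : FreeGroup.lift g v ∈ verbalOn v B := by
        rw [hv.verbalOn_congr (B := A) fun i hi => Function.update_of_ne (by grind) _ _]
        exact lift_mem_verbalOn v hg
      set a := FreeGroup.lift g u
      set a' := FreeGroup.lift (Function.update g j (g j * k)) u
      set b := FreeGroup.lift g v
      -- With `a' = a * r` the quotient is `[[a, b], r] * [r, b]`.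
      obtain ⟨r, hr⟩ : ∃ r, r = a⁻¹ * a' := ⟨_, rfl⟩
      rw [← hr] at ihu
      have ha' : a' = a * r := by rw [hr]; group
      have hc : a⁻¹ * b⁻¹ * a * b ∈ verbalOn v B := by
        simpa using mul_mem (hVn.conj_mem _ (inv_mem hb) a⁻¹) hb
      have h1 := Subgroup.commutator_mem_commutator (inv_mem ihu) (inv_mem hc)
      have h2 := Subgroup.commutator_mem_commutator (inv_mem ihu) (inv_mem hb)
      have := mul_mem (inv_mem h1) h2
      convert this using 1
      rw [ha']
      simp only [commutatorElement_def]
      group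
    · have hjs : j ∉ s := hst.notMem_of_mem_right hj
      have ihv := ihv hj
      rw [hu.lift_update_of_notMem hjs]
      have ha : FreeGroup.lift g u ∈ verbalOn u B := by
        rw [hu.verbalOn_congr (B := A) fun i hi => Function.update_of_ne (by grind) _ _]
        exact lift_mem_verbalOn u hg
      set a := FreeGroup.lift g u
      set b' := FreeGroup.lift (Function.update g j (g j * k)) v
      set b := FreeGroup.lift g v
      -- With `b' = b * r` and `c = [a, b]` the quotient is `c⁻¹ * [a, r] * c * [c, r]`.
      obtain ⟨r, hr⟩ : ∃ r, r = b⁻¹ * b' := ⟨_, rfl⟩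
      rw [← hr] at ihv
      have hb' : b' = b * r := by rw [hr]; group
      have hc : a⁻¹ * b⁻¹ * a * b ∈ verbalOn u B := by
        have := mul_mem (inv_mem ha) (hUn.conj_mem _ ha b⁻¹)
        simpa [mul_assoc] using this
      have h1 := Subgroup.commutator_mem_commutator (inv_mem ha) (inv_mem ihv)
      have h2 := Subgroup.commutator_mem_commutator (inv_mem hc) (inv_mem ihv)
      have h3 := (Subgroup.commutator_normal (verbalOn u B) (verbalOn v B)).conj_mem _ h1
        (a⁻¹ * b⁻¹ * a * b)⁻¹
      have := mul_mem h3 h2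
      convert this using 1
      rw [hb']
      simp only [commutatorElement_def]
      group

/-- Arguments that are congruent modulo the `K j` have values that are congruent modulo any
subgroup containing all values that take some argument from its `K j`. -/
lemma inv_lift_mul_lift_mem [Fintype ι] (hw : IsMultilinearCommutatorOn s w)
    {A K : ι → Subgroup G} (hA : ∀ i, (A i).Normal) (hK : ∀ i, (K i).Normal) {T : Subgroup G}
    (hT : ∀ j ∈ s, ∀ h : ι → G, (∀ i, i ≠ j → h i ∈ A i) → h j ∈ K j → FreeGroup.lift h w ∈ T)
    {g g' : ι → G} (hg : ∀ i, g i ∈ A i) (hg' : ∀ i, g' i ∈ A i)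
    (hgg' : ∀ i ∈ s, (g i)⁻¹ * g' i ∈ K i) :
    (FreeGroup.lift g w)⁻¹ * FreeGroup.lift g' w ∈ T := by
  classical
  -- Pass from `g` to `g'` one argument at a time.
  have key : ∀ J : Finset ι,
      (FreeGroup.lift g w)⁻¹ * FreeGroup.lift (J.piecewise g' g) w ∈ T := by
    intro J
    induction J using Finset.induction_on with
    | empty => simp [one_mem]
    | insert j J hj ih =>
      have hx : ∀ i, J.piecewise g' g i ∈ A i := fun i => by
        by_cases h : i ∈ J <;> simp [h, hg, hg']
      by_cases hjs : j ∈ s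
      · have h1 := hw.inv_lift_mul_lift_update_mem hjs hA (hK j) hx (hgg' j hjs)
        have h2 : verbalOn w (Function.update A j (K j)) ≤ T := by
          refine verbalOn_le.2 fun h hh => hT j hjs h (fun i hi => ?_) ?_
          · simpa [hi] using hh i
          · simpa using hh j
        have h3 := mul_mem ih (h2 h1)
        rw [Finset.piecewise_insert]
        simpa [hj, mul_assoc] using h3
      · rwa [Finset.piecewise_insert, hw.lift_update_of_notMem hjs]
  simpa using key Finset.univ

/-- Splitting a product `y * k` in one argument: the value is a product of the value at `k` and of
the value at `y` with all arguments twisted by conjugators from any normal subgroup containing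
`k`. -/
lemma exists_lift_update_mul [DecidableEq ι] (hw : IsMultilinearCommutatorOn s w) {j : ι}
    (hj : j ∈ s) {K : Subgroup G} (hK : K.Normal) (g : ι → G) (y : G) {k : G} (hk : k ∈ K) :
    ∃ c : ι → G, (∀ i, c i ∈ K) ∧ FreeGroup.lift (Function.update g j (y * k)) w =
      FreeGroup.lift (fun i => (c i)⁻¹ * Function.update g j y i * c i) w *
        FreeGroup.lift (Function.update g j k) w := by
  classical
  induction hw with
  | var a =>
    rcases hj with rfl
    exact ⟨fun _ => 1, fun _ => one_mem _, by simp⟩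
  | @comm s t u v hu hv hst ihu ihv =>
    -- `[a b, v] = [a ^ b, v ^ b] [b, v]`, and `[u, a b] = [u ^ d, a ^ d] [u, b]` for
    -- `d = b [u, b]⁻¹`.
    rcases hj with hj | hj
    · obtain ⟨c, hc, hcu⟩ := ihu hj
      have hjt : j ∉ t := hst.notMem_of_mem_left hj
      have hbK : FreeGroup.lift (Function.update g j k) u ∈ K :=
        hu.lift_mem_of_normal hj (by simpa)
      set b := FreeGroup.lift (Function.update g j k) u
      refine ⟨fun i => if i ∈ s then c i * b else b, fun i => ?_, ?_⟩
      · dsimp only; split_ifs; exacts [mul_mem (hc i) hbK, hbK]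
      · simp only [map_mul, map_inv]
        rw [hu.lift_congr (g := fun i => (if i ∈ s then c i * b else b)⁻¹ *
            Function.update g j y i * (if i ∈ s then c i * b else b))
            (g' := fun i => b⁻¹ * ((c i)⁻¹ * Function.update g j y i * c i) * b)
            (fun i hi => by simp [hi, mul_assoc]),
          hv.lift_congr (g := fun i => (if i ∈ s then c i * b else b)⁻¹ *
            Function.update g j y i * (if i ∈ s then c i * b else b))
            (g' := fun i => b⁻¹ * Function.update g j y i * b)
            (fun i hi => by simp [hst.notMem_of_mem_right hi]),
          lift_conj_inv, lift_conj_inv, hcu]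
        simp only [hv.lift_update_of_notMem hjt]
        change _ = _ * (b⁻¹ * _ * b * _)
        group
    · obtain ⟨c, hc, hcv⟩ := ihv hj
      have hjs : j ∉ s := hst.notMem_of_mem_right hj
      have hbK : FreeGroup.lift (Function.update g j k) v ∈ K :=
        hv.lift_mem_of_normal hj (by simpa)
      set b := FreeGroup.lift (Function.update g j k) v
      set a := FreeGroup.lift g u with ha
      obtain ⟨d, hd⟩ : ∃ d, d = b * (a⁻¹ * b⁻¹ * a * b)⁻¹ := ⟨_, rfl⟩
      have hdK : d ∈ K := by
        have h : a⁻¹ * b⁻¹ * a * b ∈ K := by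
          simpa using mul_mem (hK.conj_mem _ (inv_mem hbK) a⁻¹) hbK
        exact hd ▸ mul_mem hbK (inv_mem h)
      refine ⟨fun i => if i ∈ s then d else c i * d, fun i => ?_, ?_⟩
      · dsimp only; split_ifs; exacts [hdK, mul_mem (hc i) hdK]
      · simp only [map_mul, map_inv]
        rw [hv.lift_congr (g := fun i => (if i ∈ s then d else c i * d)⁻¹ *
            Function.update g j y i * (if i ∈ s then d else c i * d))
            (g' := fun i => d⁻¹ * ((c i)⁻¹ * Function.update g j y i * c i) * d)
            (fun i hi => by simp [hst.notMem_of_mem_right hi, mul_assoc]),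
          hu.lift_congr (g := fun i => (if i ∈ s then d else c i * d)⁻¹ *
            Function.update g j y i * (if i ∈ s then d else c i * d))
            (g' := fun i => d⁻¹ * Function.update g j y i * d)
            (fun i hi => by simp [hi]),
          lift_conj_inv, lift_conj_inv, hcv]
        simp only [hu.lift_update_of_notMem hjs]
        rw [← ha]
        change _ = _ * (_ * b⁻¹ * _ * b)
        rw [hd]
        group

end IsMultilinearCommutatorOn

/-! ### Bounding orders by Baire category -/

section Baire

variable {ι G : Type*} [Group G] [TopologicalSpace G] [IsTopologicalGroup G]

lemma continuous_freeGroup_lift (w : FreeGroup ι) :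
    Continuous fun g : ι → G => FreeGroup.lift g w := by
  induction w using FreeGroup.induction_on with
  | C1 => simpa using continuous_const
  | of i => simpa using continuous_apply i
  | inv_of i ih => simp only [map_inv]; exact ih.inv
  | mul x y hx hy => simp only [map_mul]; exact hx.mul hy

/-- Baire category: if all values of a word on a product of closed subgroups `A i` of a profinite
group have finite order, then every coset of an open subgroup of this product contains a smaller
such coset on which the orders divide a fixed number. -/
lemma exists_coset_lift_pow_eq_one [Finite ι] [CompactSpace G] [TotallyDisconnectedSpace G]
    (w : FreeGroup ι) {A : ι → Subgroup G} (hA : ∀ i, IsClosed (A i : Set G))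
    (hfin : ∀ g : ι → G, (∀ i, g i ∈ A i) → IsOfFinOrder (FreeGroup.lift g w))
    {M : Subgroup G} (hM : IsOpen (M : Set G)) {g : ι → G} (hg : ∀ i, g i ∈ A i) :
    ∃ M' : Subgroup G, M'.Normal ∧ IsOpen (M' : Set G) ∧ M' ≤ M ∧ ∃ m : ℕ, 0 < m ∧ ∃ y : ι → G,
      (∀ i, y i ∈ A i) ∧ (∀ i, (g i)⁻¹ * y i ∈ M) ∧
      ∀ h : ι → G, (∀ i, h i ∈ A i) → (∀ i, (y i)⁻¹ * h i ∈ M') →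
        FreeGroup.lift h w ^ m = 1 := by
  have : Fintype ι := Fintype.ofFinite ι
  have hMc : IsClosed (M : Set G) := M.isClosed_of_isOpen hM
  have : ∀ i, CompactSpace ↥(A i ⊓ M) := fun i =>
    isCompact_iff_compactSpace.1 ((hA i).inter hMc).isCompact
  let P := (i : ι) → ↥(A i ⊓ M)
  let F : ℕ → Set P := fun m =>
    {p | FreeGroup.lift (fun i => g i * (p i : G)) w ^ (m + 1) = 1}
  have hcont : Continuous fun p : P => FreeGroup.lift (fun i => g i * (p i : G)) w :=
    (continuous_freeGroup_lift w).comp (by fun_prop)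
  have hF : ∀ m, IsClosed (F m) := fun m => isClosed_eq (hcont.pow _) continuous_const
  have hU : ⋃ m, F m = Set.univ := by
    refine Set.eq_univ_of_forall fun p => Set.mem_iUnion.2 ?_
    obtain ⟨m, hm, h⟩ := isOfFinOrder_iff_pow_eq_one.1
      (hfin (fun i => g i * (p i : G)) fun i => mul_mem (hg i) (p i).2.1)
    exact ⟨m - 1, by simpa [F, Nat.sub_add_cancel hm] using h⟩
  obtain ⟨m, p, hp⟩ := nonempty_interior_of_iUnion_of_closed hF hU
  -- A neighbourhood of `p` in the product inside `F m`, shrunk to a coset of an open subgroup.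
  have hind : Topology.IsInducing (fun q : P => fun i => (p i : G)⁻¹ * (q i : G)) := by
    have h1 : Topology.IsInducing (fun q : P => fun i => (q i : G)) :=
      Topology.IsInducing.piMap (f := fun i (x : ↥(A i ⊓ M)) => (x : G)) fun i => ⟨rfl⟩
    exact (Homeomorph.mulLeft (fun i => (p i : G)⁻¹)).isInducing.comp h1
  have hnhds := mem_interior_iff_mem_nhds.1 hp
  rw [hind.nhds_eq_comap, Filter.mem_comap] at hnhds
  obtain ⟨U, hU1, hU2⟩ := hnhds
  have h1 : (fun i => (p i : G)⁻¹ * (p i : G)) = fun _ => (1 : G) := by ext; simp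
  rw [h1, nhds_pi, Filter.mem_pi'] at hU1
  obtain ⟨I, V, hV, hVU⟩ := hU1
  have hV' : (⋂ i, V i) ∩ (M : Set G) ∈ nhds (1 : G) :=
    Filter.inter_mem (Filter.iInter_mem.2 hV) (hM.mem_nhds (one_mem M))
  obtain ⟨O, hOsub, hO, h1O⟩ := mem_nhds_iff.1 hV'
  obtain ⟨M', hM'n, hM'o, hM'⟩ : ∃ M' : Subgroup G, M'.Normal ∧ IsOpen (M' : Set G) ∧
      (M' : Set G) ⊆ O := by
    obtain ⟨M', hM'⟩ := ProfiniteGrp.exist_openNormalSubgroup_sub_open_nhds_of_one hO h1O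
    exact ⟨M'.toSubgroup, M'.isNormal', M'.isOpen', hM'⟩
  refine ⟨M', hM'n, hM'o, fun x hx => (hOsub (hM' hx)).2, m + 1,
    Nat.succ_pos _, fun i => g i * (p i : G), fun i => mul_mem (hg i) (p i).2.1,
    fun i => by simpa using (p i).2.2, fun h hh hhM => ?_⟩
  have hsub : ∀ i, (p i : G)⁻¹ * ((g i)⁻¹ * h i) ∈ M' := fun i => by
    simpa [mul_assoc] using hhM i
  have hq : ∀ i, (g i)⁻¹ * h i ∈ A i ⊓ M := fun i => by
    refine Subgroup.mem_inf.2 ⟨mul_mem (inv_mem (hg i)) (hh i), ?_⟩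
    have := mul_mem (show (p i : G) ∈ M from (p i).2.2) (hOsub (hM' (hsub i))).2
    simpa using this
  have : (fun i => ⟨(g i)⁻¹ * h i, hq i⟩ : P) ∈ F m := hU2 <| hVU <| by
    intro i _
    exact Set.mem_iInter.1 (hOsub (hM' (hsub i))).1 i
  have h2 : FreeGroup.lift (fun i => g i * ((g i)⁻¹ * h i)) w ^ (m + 1) = 1 := this
  simpa only [mul_inv_cancel_left] using h2

end Baire

/-- If `[W, W] ≤ N` with `N` normal, the elements of `W` whose `m`-th power lies in `N` form a
subgroup. -/
def powMemSubgroup {G : Type*} [Group G] (W N : Subgroup G) [N.Normal] (h : ⁅W, W⁆ ≤ N) (m : ℕ) :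
    Subgroup G where
  carrier := {x | x ∈ W ∧ x ^ m ∈ N}
  one_mem' := ⟨one_mem _, by simp [one_mem]⟩
  inv_mem' := fun {x} hx => ⟨inv_mem hx.1, by simpa using hx.2⟩
  mul_mem' := fun {x y} hx hy => by
    refine ⟨mul_mem hx.1 hy.1, ?_⟩
    have hc : Commute (x : G ⧸ N) (y : G ⧸ N) := by
      rw [← commutatorElement_eq_one_iff_commute]
      exact (QuotientGroup.eq_one_iff _).2 (h (Subgroup.commutator_mem_commutator hx.1 hy.1))
    have h1 := (QuotientGroup.eq_one_iff (N := N) _).2 hx.2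
    have h2 := (QuotientGroup.eq_one_iff (N := N) _).2 hy.2
    rw [QuotientGroup.mk_pow] at h1 h2
    rw [← QuotientGroup.eq_one_iff, QuotientGroup.mk_pow, QuotientGroup.mk_mul, hc.mul_pow, h1, h2,
      one_mul]

/-- Let `w(A)` be abelian modulo `N`. If the values on the coset `y M'` have exponent `m` modulo
`N`, then so have the values whose arguments in `J` come from `M'` itself, the others still coming
from the coset. -/
lemma IsMultilinearCommutatorOn.pow_mem_of_coset {ι G : Type*} [Group G] {s : Set ι}
    {w : FreeGroup ι} (hw : IsMultilinearCommutatorOn s w) {A : ι → Subgroup G}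
    (hA : ∀ i, (A i).Normal) {N : Subgroup G} [N.Normal]
    (hN : ⁅verbalOn w A, verbalOn w A⁆ ≤ N) {M' : Subgroup G} (hM' : M'.Normal) {m : ℕ} {y : ι → G}
    (hy : ∀ i, y i ∈ A i) (hcoset : ∀ h : ι → G, (∀ i, h i ∈ A i) →
      (∀ i, (y i)⁻¹ * h i ∈ M') → FreeGroup.lift h w ^ m ∈ N) (J : Finset ι) {h : ι → G}
    (hh : ∀ i, h i ∈ A i) (hJ : ∀ i ∈ J, h i ∈ M') (hJ' : ∀ i ∉ J, (y i)⁻¹ * h i ∈ M') :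
    FreeGroup.lift h w ^ m ∈ N := by
  classical
  induction J using Finset.induction_on generalizing h with
  | empty => exact hcoset h hh fun i => hJ' i (by simp)
  | insert j J hj ih =>
    have hupd : ∀ x ∈ A j, (y j)⁻¹ * x ∈ M' →
        (∀ i, Function.update h j x i ∈ A i) ∧ (∀ i ∈ J, Function.update h j x i ∈ M') ∧
        ∀ i ∉ J, (y i)⁻¹ * Function.update h j x i ∈ M' := by
      refine fun x hx hxM => ⟨fun i => ?_, fun i hi => ?_, fun i hi => ?_⟩
      · by_cases hij : i = j
        · subst hij; simpa
        · simpa [hij] using hh i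
      · have hij : i ≠ j := by grind
        simpa [hij] using hJ i (Finset.mem_insert_of_mem hi)
      · by_cases hij : i = j
        · subst hij; simpa
        · simpa [hij] using hJ' i (by simp [hij, hi])
    by_cases hjs : j ∈ s
    · have hk : h j ∈ M' ⊓ A j := ⟨hJ j (by simp), hh j⟩
      obtain ⟨c, hc, hcw⟩ := hw.exists_lift_update_mul hjs
        (K := M' ⊓ A j) (Subgroup.normal_inf_normal _ _) h (y j) hk
      rw [Function.update_eq_self] at hcw
      obtain ⟨h1, h2, h3⟩ := hupd (y j * h j) (mul_mem (hy j) (hh j)) (by simpa using hk.1)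
      obtain ⟨h1', h2', h3'⟩ := hupd (y j) (hy j) (by simp [one_mem])
      set f := Function.update h j (y j)
      have e1 := ih h1 h2 h3
      have hconj : ∀ (K : Subgroup G), K.Normal → ∀ x ∈ K, ∀ c, c⁻¹ * x * c ∈ K :=
        fun K hK x hx c => by simpa using hK.conj_mem x hx c⁻¹
      have h1'' : ∀ i, (c i)⁻¹ * f i * c i ∈ A i := fun i => hconj _ (hA i) _ (h1' i) _
      have e2 : FreeGroup.lift (fun i => (c i)⁻¹ * f i * c i) w ^ m ∈ N := by
        refine ih h1'' (fun i hi => hconj _ hM' _ (h2' i hi) _) fun i hi => ?_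
        have := mul_mem (mul_mem (hconj _ hM' _ (inv_mem (hc i).1) (y i)) (h3' i hi)) (hc i).1
        simpa [mul_assoc] using this
      have := mul_mem (inv_mem (show _ ∈ powMemSubgroup _ N hN m from
        ⟨lift_mem_verbalOn w h1'', e2⟩)) (show _ ∈ powMemSubgroup _ N hN m from
        ⟨lift_mem_verbalOn w h1, e1⟩)
      rw [hcw, inv_mul_cancel_left] at this
      exact this.2
    · rw [← hw.lift_update_of_notMem hjs h (y j)]
      obtain ⟨h1, h2, h3⟩ := hupd (y j) (hy j) (by simp [one_mem])
      exact ih h1 h2 h3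

/-- If `w` has values of finite order on closed normal subgroups `A i` of a profinite group and
`w(A)` is abelian modulo `N`, then `w(A)` has finite exponent modulo `N`. The subgroup `N` need not
be closed. -/
theorem IsMultilinearCommutatorOn.exists_pow_mem {ι G : Type*} [Finite ι] [Group G]
    [TopologicalSpace G] [IsTopologicalGroup G] [CompactSpace G] [TotallyDisconnectedSpace G]
    {s : Set ι} {w : FreeGroup ι} (hw : IsMultilinearCommutatorOn s w) {A : ι → Subgroup G}
    (hA : ∀ i, (A i).Normal) (hAc : ∀ i, IsClosed (A i : Set G)) {N : Subgroup G} (hNn : N.Normal)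
    (hN : ⁅verbalOn w A, verbalOn w A⁆ ≤ N)
    (hfin : ∀ g : ι → G, (∀ i, g i ∈ A i) → IsOfFinOrder (FreeGroup.lift g w)) :
    ∃ m : ℕ, 0 < m ∧ ∀ x ∈ verbalOn w A, x ^ m ∈ N := by
  classical
  have : Fintype ι := Fintype.ofFinite ι
  -- Induction on the number `t` of arguments that are allowed to lie outside an open subgroup `M`.
  have key : ∀ t : ℕ, ∃ M : Subgroup G, M.Normal ∧ IsOpen (M : Set G) ∧ ∃ m : ℕ, 0 < m ∧
      ∀ I : Finset ι, I.card < t → ∀ g : ι → G, (∀ i, g i ∈ A i) → (∀ i ∉ I, g i ∈ M) →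
        FreeGroup.lift g w ^ m ∈ N := by
    intro t
    induction t with
    | zero => exact ⟨⊤, inferInstance, isOpen_univ, 1, one_pos, by simp⟩
    | succ t ih =>
      obtain ⟨M, hMn, hMo, m, hm, hMm⟩ := ih
      have hfi : Finite (G ⧸ M) := Subgroup.quotient_finite_of_isOpen M hMo
      -- For every coset `q` of `M` in the product that meets the `A i`: data from Baire category.
      have hB : ∀ q : ι → G ⧸ M, ∃ M' : Subgroup G, M'.Normal ∧ IsOpen (M' : Set G) ∧ M' ≤ M ∧
          ∃ m' : ℕ, 0 < m' ∧ ∀ g : ι → G, (∀ i, g i ∈ A i) → (∀ i, (g i : G ⧸ M) = q i) →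
          ∃ y : ι → G, (∀ i, y i ∈ A i) ∧ (∀ i, (g i)⁻¹ * y i ∈ M) ∧
          ∀ h : ι → G, (∀ i, h i ∈ A i) → (∀ i, (y i)⁻¹ * h i ∈ M') →
            FreeGroup.lift h w ^ m' = 1 := by
        intro q
        by_cases hq : ∃ g : ι → G, (∀ i, g i ∈ A i) ∧ ∀ i, (g i : G ⧸ M) = q i
        · obtain ⟨g, hg, hgq⟩ := hq
          obtain ⟨M', h1, h2, h3, m', h4, y, h5, h6, h7⟩ :=
            exists_coset_lift_pow_eq_one w hAc hfin hMo hg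
          refine ⟨M', h1, h2, h3, m', h4, fun g' hg' hgq' => ⟨y, h5, fun i => ?_, h7⟩⟩
          have : (g' i)⁻¹ * g i ∈ M := QuotientGroup.eq.1 (by rw [hgq, hgq'])
          simpa [mul_assoc] using mul_mem this (h6 i)
        · exact ⟨M, hMn, hMo, le_rfl, 1, one_pos, fun g hg hgq => absurd ⟨g, hg, hgq⟩ hq⟩
      choose M' hM'n hM'o hM'le m' hm' hy using hB
      have : Fintype (ι → G ⧸ M) := Fintype.ofFinite _
      refine ⟨⨅ q, M' q, Subgroup.normal_iInf_normal hM'n, ?_, m * ∏ q, m' q,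
        Nat.mul_pos hm (Finset.prod_pos fun q _ => hm' q), fun I hI g hg hgI => ?_⟩
      · rw [Subgroup.coe_iInf]
        exact isOpen_iInter_of_finite hM'o
      obtain ⟨q, hq⟩ : ∃ q : ι → G ⧸ M, ∀ i, (g i : G ⧸ M) = q i := ⟨_, fun _ => rfl⟩
      obtain ⟨y, hyA, hyM, hyw⟩ := hy q g hg hq
      have hgI' : ∀ i ∉ I, g i ∈ M' q := fun i hi => Subgroup.mem_iInf.1 (hgI i hi) q
      -- The arguments outside `I` of the Baire coset can be moved to those of `g`.
      have hg'A : ∀ i, I.piecewise y g i ∈ A i := fun i => by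
        by_cases h : i ∈ I <;> simp [h, hg, hyA]
      have h1 : FreeGroup.lift (I.piecewise y g) w ^ m' q ∈ N := by
        refine hw.pow_mem_of_coset hA hN (hM'n q) hyA
          (fun h hh hhM => by simp [hyw h hh hhM, one_mem]) Iᶜ hg'A (fun i hi => ?_)
          fun i hi => ?_
        · have hi : i ∉ I := by simpa using hi
          simpa [hi] using hgI' i hi
        · have hi : i ∈ I := by simpa using hi
          simp [hi, one_mem]
      -- Those in `I` only matter modulo `M`, up to values with fewer arguments outside `M`.
      have h2 : (FreeGroup.lift (I.piecewise y g) w)⁻¹ * FreeGroup.lift g w ∈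
          powMemSubgroup (verbalOn w A) N hN m := by
        refine hw.inv_lift_mul_lift_mem (A := fun i => if i ∈ I then A i else A i ⊓ M)
          (K := fun i => if i ∈ I then A i ⊓ M else ⊥) (fun i => ?_) (fun i => ?_)
          (fun j hj h hh hhj => ?_) (fun i => ?_) (fun i => ?_) (fun i _ => ?_)
        · have := hA i
          split_ifs <;> infer_instance
        · have := hA i
          split_ifs <;> infer_instance
        · by_cases hjI : j ∈ I
          · simp only [hjI, if_true] at hhj
            have hhA : ∀ i, h i ∈ A i := fun i => by
              by_cases hij : i = j
              · subst hij; exact hhj.1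
              · have := hh i hij
                split_ifs at this
                exacts [this, this.1]
            refine ⟨lift_mem_verbalOn w hhA, hMm (I.erase j) ?_ h hhA fun i hi => ?_⟩
            · rw [Finset.card_erase_of_mem hjI]
              have := Finset.card_pos.2 ⟨j, hjI⟩
              omega
            · by_cases hij : i = j
              · subst hij; exact hhj.2
              · have hi : i ∉ I := by simpa [hij] using hi
                have := hh i hij
                rw [if_neg hi] at this
                exact this.2
          · simp only [hjI, if_false] at hhj
            have := hw.lift_mem_of_normal hj hhj
            rw [Subgroup.mem_bot.1 this]
            exact one_mem _
        · by_cases hi : i ∈ I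
          · simpa [hi] using hyA i
          · simpa [hi] using ⟨hg i, hM'le q (hgI' i hi)⟩
        · by_cases hi : i ∈ I
          · simpa [hi] using hg i
          · simpa [hi] using ⟨hg i, hM'le q (hgI' i hi)⟩
        · by_cases hi : i ∈ I
          · have := inv_mem (hyM i)
            simpa [hi] using ⟨mul_mem (inv_mem (hyA i)) (hg i), by simpa using this⟩
          · simp [hi]
      have hlift : ∀ (x : G) (a b : ℕ), a ∣ b → x ^ a ∈ N → x ^ b ∈ N := by
        rintro x a _ ⟨c, rfl⟩ hx
        rw [pow_mul]
        exact pow_mem hx c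
      have hdvd : m' q ∣ m * ∏ q, m' q :=
        (Finset.dvd_prod_of_mem m' (Finset.mem_univ q)).mul_left m
      have := mul_mem (show _ ∈ powMemSubgroup _ N hN (m * ∏ q, m' q) from
        ⟨lift_mem_verbalOn w hg'A, hlift _ _ _ hdvd h1⟩)
        (show _ ∈ powMemSubgroup _ N hN (m * ∏ q, m' q) from
          ⟨h2.1, hlift _ _ _ (Dvd.intro _ rfl) h2.2⟩)
      rw [mul_inv_cancel_left] at this
      exact this.2
  obtain ⟨M, -, -, m, hm, h⟩ := key (Fintype.card ι + 1)
  refine ⟨m, hm, fun x hx => ?_⟩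
  have : verbalOn w A ≤ powMemSubgroup (verbalOn w A) N hN m := verbalOn_le.2 fun g hg =>
    ⟨lift_mem_verbalOn w hg, h Finset.univ (by simp) g hg (by simp)⟩
  exact (this hx).2

/-! ### Finiteness of torsion groups -/

section TorsionGroups

lemma Group.finite_of_fg_isSolvable {Γ : Type*} [Group Γ] [Group.FG Γ] [Group.IsSolvable Γ]
    (ht : ∀ x : Γ, IsOfFinOrder x) : Finite Γ := by
  have key : ∀ n, (derivedSeries Γ n).FiniteIndex := by
    intro n
    induction n with
    | zero => rw [derivedSeries_zero]; infer_instance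
    | succ n ih =>
      set D := derivedSeries Γ n
      have hfg : Group.FG D := inferInstance
      have htors : ∀ x : Abelianization D, IsOfFinOrder x := by
        intro x
        obtain ⟨y, rfl⟩ := QuotientGroup.mk_surjective x
        have hy : IsOfFinOrder y := by
          rw [← Submonoid.isOfFinOrder_coe]
          exact ht _
        exact (QuotientGroup.mk' (commutator D)).isOfFinOrder hy
      have hfin : Finite (Abelianization D) := by
        have : Group.FG (Abelianization D) :=
          inferInstanceAs (Group.FG (D ⧸ commutator D))
        exact CommGroup.finite_of_fg_isMulTorsion _ htors
      have hfi : (commutator D).FiniteIndex := by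
        have : Finite (D ⧸ commutator D) := hfin
        exact Subgroup.finiteIndex_of_finite_quotient
      rw [derivedSeries_succ, ← Subgroup.map_subtype_commutator]
      refine ⟨?_⟩
      rw [Subgroup.index_map_subtype]
      exact mul_ne_zero hfi.index_ne_zero ih.index_ne_zero
  obtain ⟨n, hn⟩ := (Group.isSolvable_def Γ).1 inferInstance
  have := (key n).index_ne_zero
  rw [hn, Subgroup.index_bot] at this
  exact Nat.finite_of_card_ne_zero this

lemma Group.finite_of_fg_of_finiteIndex_isSolvable {Γ : Type*} [Group Γ] [Group.FG Γ]
    (ht : ∀ x : Γ, IsOfFinOrder x) (H : Subgroup Γ) [H.FiniteIndex] [Group.IsSolvable H] :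
    Finite Γ := by
  have hH : Finite H := Group.finite_of_fg_isSolvable fun x => by
    rw [← Submonoid.isOfFinOrder_coe]
    exact ht _
  refine Nat.finite_of_card_ne_zero ?_
  rw [← H.card_mul_index]
  exact mul_ne_zero Nat.card_pos.ne' Subgroup.FiniteIndex.index_ne_zero

open scoped IsMulCommutative in
/-- Dietzmann's lemma: a finite set of elements of finite order that is closed under conjugation
generates a finite subgroup. -/
lemma Subgroup.finite_closure_of_conj_mem {Q : Type*} [Group Q] {S : Set Q} (hS : S.Finite)
    (hconj : ∀ x ∈ S, ∀ g : Q, g * x * g⁻¹ ∈ S) (ht : ∀ x ∈ S, IsOfFinOrder x) :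
    Finite (Subgroup.closure S) := by
  set K := Subgroup.closure S with hKdef
  have : Finite S := hS
  let act : MulAction K S :=
    { smul := fun k x => ⟨k * x * (k : Q)⁻¹, hconj _ x.2 k⟩
      one_smul := fun x => Subtype.ext (by change ((1 : K) : Q) * x * ((1 : K) : Q)⁻¹ = x; simp)
      mul_smul := fun a b x => Subtype.ext (by
        change ((a * b : K) : Q) * x * ((a * b : K) : Q)⁻¹ = a * (b * x * (b : Q)⁻¹) * (a : Q)⁻¹
        simp [mul_assoc]) }
  -- The kernel of the conjugation action on `S` centralizes a generating set.
  have hker : (MulAction.toPermHom K S).ker ≤ Subgroup.center K := by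
    intro k hk
    have h1 : ∀ x ∈ S, x * k = k * x := by
      intro x hx
      have h2 := congrArg (fun e : Equiv.Perm S => ((e ⟨x, hx⟩ : S) : Q)) hk
      have h3 : (k : Q) * x * (k : Q)⁻¹ = x := h2
      exact (mul_inv_eq_iff_eq_mul.1 h3).symm
    have h4 : K ≤ Subgroup.centralizer {(k : Q)} := by
      refine (Subgroup.closure_le _).2 fun x hx => ?_
      refine Subgroup.mem_centralizer_iff.2 ?_
      rintro _ rfl
      exact (h1 x hx).symm
    refine Subgroup.mem_center_iff.2 fun g => Subtype.ext ?_
    exact (Subgroup.mem_centralizer_iff.1 (h4 g.2) _ rfl).symm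
  have hfi : (Subgroup.center K).FiniteIndex := Subgroup.finiteIndex_of_le hker
  have hfg : Group.FG K := (Group.fg_iff_subgroup_fg _).2 ⟨hS.toFinset, by simp [hKdef]⟩
  -- The transfer `g ↦ g ^ [K : Z(K)]` is a homomorphism to an abelian group, so `K` is torsion.
  have htors : ∀ x : K, IsOfFinOrder x := by
    have h1 : ∀ x : K, IsOfFinOrder (MonoidHom.transferCenterPow K x) := by
      intro x
      have h2 : K ≤ ((CommGroup.torsion (Subgroup.center K)).comap
          (MonoidHom.transferCenterPow K)).map K.subtype := by
        refine (Subgroup.closure_le _).2 fun y hy => ?_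
        refine ⟨⟨y, Subgroup.subset_closure hy⟩, ?_, rfl⟩
        refine (MonoidHom.transferCenterPow K).isOfFinOrder ?_
        rw [← Submonoid.isOfFinOrder_coe]
        exact ht y hy
      obtain ⟨y, hy, hyx⟩ := h2 x.2
      rw [Subtype.ext hyx] at hy
      exact hy
    intro x
    have h3 := h1 x
    rw [← Submonoid.isOfFinOrder_coe, MonoidHom.transferCenterPow_apply, isOfFinOrder_pow] at h3
    exact h3.resolve_right hfi.index_ne_zero
  exact Group.finite_of_fg_of_finiteIndex_isSolvable htors (Subgroup.center K)

end TorsionGroups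

/-! ### Joins of normal subgroups of finite exponent -/

section Exponents

variable {G : Type*} [Group G]

lemma exists_pow_eq_one_sup {V W : Subgroup G} (hVn : V.Normal)
    (hV : ∃ m : ℕ, 0 < m ∧ ∀ x ∈ V, x ^ m = 1) (hW : ∃ m : ℕ, 0 < m ∧ ∀ x ∈ W, x ^ m = 1) :
    ∃ m : ℕ, 0 < m ∧ ∀ x ∈ V ⊔ W, x ^ m = 1 := by
  obtain ⟨a, ha, hV⟩ := hV
  obtain ⟨b, hb, hW⟩ := hW
  refine ⟨b * a, Nat.mul_pos hb ha, fun x hx => ?_⟩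
  obtain ⟨v, hv, y, hy, rfl⟩ := Subgroup.mem_sup_of_normal_left.1 hx
  rw [pow_mul]
  refine hV _ ?_
  rw [← QuotientGroup.eq_one_iff, QuotientGroup.mk_pow, QuotientGroup.mk_mul,
    (QuotientGroup.eq_one_iff v).2 hv, one_mul, ← QuotientGroup.mk_pow, hW y hy,
    QuotientGroup.mk_one]

lemma exists_pow_eq_one_iSup {ι : Type*} [Finite ι] {V : ι → Subgroup G} (hn : ∀ i, (V i).Normal)
    (hV : ∀ i, ∃ m : ℕ, 0 < m ∧ ∀ x ∈ V i, x ^ m = 1) :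
    ∃ m : ℕ, 0 < m ∧ ∀ x ∈ ⨆ i, V i, x ^ m = 1 := by
  classical
  have : Fintype ι := Fintype.ofFinite ι
  have key : ∀ J : Finset ι, ∃ m : ℕ, 0 < m ∧ ∀ x ∈ ⨆ i ∈ J, V i, x ^ m = 1 := by
    intro J
    induction J using Finset.induction_on with
    | empty => exact ⟨1, one_pos, by simp⟩
    | insert j J hj ih =>
      rw [Finset.iSup_insert]
      exact exists_pow_eq_one_sup (hn j) (hV j) ih
  simpa using key Finset.univ

end Exponents

/-! ### Closed series of virtually soluble groups -/

section ClosedSeries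

variable {G : Type*} [Group G] [TopologicalSpace G] [IsTopologicalGroup G]

lemma commutator_topologicalClosure_le (X Y : Subgroup G) :
    ⁅X.topologicalClosure, Y.topologicalClosure⁆ ≤ ⁅X, Y⁆.topologicalClosure := by
  rw [Subgroup.commutator_le]
  intro a ha b hb
  have hc : Continuous fun p : G × G => ⁅p.1, p.2⁆ := by
    simp only [commutatorElement_def]
    fun_prop
  exact map_mem_closure₂ hc ha hb fun x hx y hy => Subgroup.commutator_mem_commutator hx hy

/-- A virtually soluble Hausdorff topological group `G` has a descending series of closed normal
subgroups that starts with `G`, ends with `1`, and has a finite first factor and abelian later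
ones. -/
lemma IsVirtuallySoluble.exists_closed_series [T2Space G] (hG : IsVirtuallySoluble G) :
    ∃ (H : ℕ → Subgroup G) (d : ℕ), H 0 = ⊤ ∧ (H 1).FiniteIndex ∧ H d = ⊥ ∧ Antitone H ∧
      (∀ k, (H k).Normal) ∧ (∀ k, IsClosed (H k : Set G)) ∧
      ∀ k, 0 < k → ⁅H k, H k⁆ ≤ H (k + 1) := by
  obtain ⟨L, hLc, hLf, hLs⟩ := hG
  set K := L.normalCore with hK
  have hKc : IsClosed (K : Set G) := L.normalCore_isClosed hLc
  have hKs : Group.IsSolvable K :=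
    Group.isSolvable_of_isSolvable_injective (Subgroup.inclusion_injective L.normalCore_le)
  obtain ⟨n, hn⟩ := (Group.isSolvable_def K).1 hKs
  let D : ℕ → Subgroup G := fun k => (derivedSeries K k).map K.subtype
  have hD0 : D 0 = K := by simp [D, ← MonoidHom.range_eq_map]
  have hDs : ∀ k, D (k + 1) = ⁅D k, D k⁆ := fun k => by
    simp only [D, derivedSeries_succ, Subgroup.map_commutator]
  have hDn : ∀ k, (D k).Normal := fun k => by
    induction k with
    | zero => rw [hD0]; infer_instance
    | succ k ih => rw [hDs]; infer_instance
  have hDa : Antitone D := fun a b h => Subgroup.map_mono (derivedSeries_antitone K h)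
  refine ⟨fun k => Nat.casesOn k ⊤ fun k => (D k).topologicalClosure, n + 1, rfl, ?_, ?_, ?_,
    fun k => ?_, fun k => ?_, fun k hk => ?_⟩
  · have : K ≤ (D 0).topologicalClosure := by rw [hD0]; exact K.le_topologicalClosure
    exact Subgroup.finiteIndex_of_le this
  · have : D n = ⊥ := by simp [D, hn]
    change (D n).topologicalClosure = ⊥
    rw [this]
    exact SetLike.coe_injective (by simp)
  · refine antitone_nat_of_succ_le fun k => ?_
    cases k with
    | zero => exact le_top
    | succ k => exact Subgroup.topologicalClosure_mono (hDa k.le_succ)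
  · cases k with
    | zero => exact Subgroup.normal_of_characteristic ⊤
    | succ k => have := hDn k; exact Subgroup.is_normal_topologicalClosure _
  · cases k with
    | zero => exact isClosed_univ
    | succ k => exact Subgroup.isClosed_topologicalClosure _
  · cases k with
    | zero => exact absurd hk (lt_irrefl 0)
    | succ k =>
      change ⁅(D k).topologicalClosure, (D k).topologicalClosure⁆ ≤ (D (k + 1)).topologicalClosure
      rw [hDs]
      exact commutator_topologicalClosure_le _ _

end ClosedSeries

/-! ### The exponent of the verbal subgroup -/

/-- Let `A` consist of terms of a closed series as above, with a term other than `H 0` at some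
variable used by `w`. If `w` has values of finite order, then `w(A)` has finite exponent: modulo the
subgroups obtained by replacing one term by the next one, `w(A)` is abelian, because conjugation by
an element of `w(A)` changes each argument by an element of the next term. -/
lemma IsMultilinearCommutatorOn.exists_pow_eq_one_of_series {ι G : Type*} [Fintype ι] [Group G]
    [TopologicalSpace G] [IsTopologicalGroup G] [CompactSpace G] [TotallyDisconnectedSpace G]
    {s : Set ι} {w : FreeGroup ι} (hw : IsMultilinearCommutatorOn s w)
    (hfin : ∀ g : ι → G, IsOfFinOrder (FreeGroup.lift g w))
    {H : ℕ → Subgroup G} {d : ℕ} (hd : H d = ⊥) (ha : Antitone H) (hn : ∀ k, (H k).Normal)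
    (hc : ∀ k, IsClosed (H k : Set G)) (hab : ∀ k, 0 < k → ⁅H k, H k⁆ ≤ H (k + 1))
    (f : ι → ℕ) (hf : ∃ r ∈ s, 0 < f r) :
    ∃ m : ℕ, 0 < m ∧ ∀ x ∈ verbalOn w (fun i => H (f i)), x ^ m = 1 := by
  classical
  induction hN : ∑ i, (d - f i) using Nat.strong_induction_on generalizing f with
  | _ N ih =>
  by_cases hdone : ∃ j ∈ s, d ≤ f j
  · obtain ⟨j, hj, hdj⟩ := hdone
    refine ⟨1, one_pos, fun x hx => ?_⟩
    have h1 := ha hdj (hw.verbalOn_le_of_mem hj (hn _) hx)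
    rw [hd, Subgroup.mem_bot] at h1
    simp [h1]
  push Not at hdone
  obtain ⟨r, hr, hfr⟩ := hf
  let V : ι → Subgroup G := fun j =>
    if j ∈ s then verbalOn w (fun i => H (Function.update f j (f j + 1) i)) else ⊥
  have hVn : ∀ j, (V j).Normal := fun j => by
    have := verbalOn_normal w (A := fun i => H (Function.update f j (f j + 1) i)) fun i => hn _
    simp only [V]
    split_ifs <;> infer_instance
  have hV : ∀ j, ∃ m : ℕ, 0 < m ∧ ∀ x ∈ V j, x ^ m = 1 := by
    intro j
    by_cases hj : j ∈ s
    · simp only [V, hj, if_true]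
      refine ih _ ?_ _ ⟨r, hr, ?_⟩ rfl
      · rw [← hN]
        refine Finset.sum_lt_sum (fun i _ => ?_) ⟨j, Finset.mem_univ j, ?_⟩
        · by_cases hij : i = j
          · subst hij; simp; omega
          · simp [hij]
        · have := hdone j hj
          simp
          omega
      · by_cases hrj : r = j
        · subst hrj; simp
        · simpa [hrj] using hfr
    · exact ⟨1, one_pos, by simp [V, hj]⟩
  set R := ⨆ j, V j
  have hRn : R.Normal := Subgroup.iSup_normal V
  have hcomm : ⁅verbalOn w (fun i => H (f i)), verbalOn w (fun i => H (f i))⁆ ≤ R := by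
    rw [Subgroup.commutator_le]
    intro x hx y hy
    have h1 : verbalOn w (fun i => H (f i)) ≤
        (Subgroup.centralizer {(x : G ⧸ R)}).comap (QuotientGroup.mk' R) := by
      refine verbalOn_le.2 fun g hg => ?_
      rw [Subgroup.mem_comap, Subgroup.mem_centralizer_iff]
      rintro _ rfl
      have h2 := hw.inv_lift_mul_lift_mem (A := fun i => H (f i)) (K := fun i => H (f i + 1))
        (T := R) (g := g) (g' := fun i => x * g i * x⁻¹) (fun i => hn _) (fun i => hn _)
        (fun j hj h hh hhj => ?_) hg (fun i => (hn _).conj_mem _ (hg i) x) (fun i hi => ?_)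
      · rw [lift_conj, ← QuotientGroup.eq] at h2
        simp only [QuotientGroup.mk_mul, QuotientGroup.mk_inv] at h2
        exact (eq_mul_inv_iff_mul_eq.1 h2).symm
      · refine Subgroup.mem_iSup_of_mem j ?_
        simp only [V, hj, if_true]
        refine lift_mem_verbalOn w fun i => ?_
        by_cases hij : i = j
        · subst hij; simpa using hhj
        · simpa [hij] using hh i hij
      · have hgx : (g i)⁻¹ * (x * g i * x⁻¹) = ⁅(g i)⁻¹, x⁆ := by
          rw [commutatorElement_def]; group
        rw [hgx]
        rcases Nat.eq_zero_or_pos (f i) with h0 | h0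
        -- No commutativity is available in `H 0`, but `x` lies in `H 1` because of `r`.
        · rw [h0, zero_add]
          have hx1 : x ∈ H 1 := ha hfr (hw.verbalOn_le_of_mem hr (hn _) hx)
          have := hn 1
          exact Subgroup.commutator_le_right ⊤ (H 1)
            (Subgroup.commutator_mem_commutator (Subgroup.mem_top _) hx1)
        · exact hab _ h0 (Subgroup.commutator_mem_commutator (inv_mem (hg i))
            (hw.verbalOn_le_of_mem hi (hn _) hx))
    have h3 := Subgroup.mem_centralizer_iff.1 (h1 hy) _ rfl
    rw [← QuotientGroup.eq_one_iff, ← QuotientGroup.mk'_apply R, map_commutatorElement]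
    exact commutatorElement_eq_one_iff_mul_comm.2 h3
  obtain ⟨m, hm, hmR⟩ := hw.exists_pow_mem (fun i => hn (f i)) (fun i => hc (f i)) hRn hcomm
    fun g _ => hfin g
  obtain ⟨e, he, heR⟩ := exists_pow_eq_one_iSup hVn hV
  exact ⟨m * e, Nat.mul_pos hm he, fun x hx => by rw [pow_mul]; exact heR _ (hmR x hx)⟩

/-- The abstract verbal subgroup has finite exponent: modulo the subgroups that take some argument
from the finite-index term `H 1` there are finitely many values, and Dietzmann's lemma applies. -/
lemma IsMultilinearCommutator.exists_pow_eq_one {ι G : Type*} [Fintype ι] [Group G]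
    [TopologicalSpace G] [IsTopologicalGroup G] [CompactSpace G] [TotallyDisconnectedSpace G]
    {w : FreeGroup ι} (hw : IsMultilinearCommutator w) (hG : IsVirtuallySoluble G)
    (hfin : ∀ x ∈ wordValues w G, IsOfFinOrder x) :
    ∃ m : ℕ, 0 < m ∧ ∀ x ∈ Subgroup.closure (wordValues w G), x ^ m = 1 := by
  classical
  obtain ⟨s, hw⟩ := hw
  have hfin' : ∀ g : ι → G, IsOfFinOrder (FreeGroup.lift g w) := fun g => hfin _ ⟨g, rfl⟩
  obtain ⟨H, d, h0, h1, hd, ha, hn, hc, hab⟩ := hG.exists_closed_series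
  let V : ι → Subgroup G := fun j =>
    if j ∈ s then verbalOn w (fun i => H (Function.update (fun _ => 0) j 1 i)) else ⊥
  have hVn : ∀ j, (V j).Normal := fun j => by
    have := verbalOn_normal w (A := fun i => H (Function.update (fun _ => 0) j 1 i)) fun i => hn _
    simp only [V]
    split_ifs <;> infer_instance
  have hV : ∀ j, ∃ m : ℕ, 0 < m ∧ ∀ x ∈ V j, x ^ m = 1 := by
    intro j
    by_cases hj : j ∈ s
    · simp only [V, hj, if_true]
      exact hw.exists_pow_eq_one_of_series hfin' hd ha hn hc hab _ ⟨j, hj, by simp⟩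
    · exact ⟨1, one_pos, by simp [V, hj]⟩
  set R := ⨆ j, V j
  have hRn : R.Normal := Subgroup.iSup_normal V
  -- Modulo `R` a value depends only on the cosets of its arguments modulo `H 1`.
  have hmod : ∀ g g' : ι → G, (∀ i, (g i)⁻¹ * g' i ∈ H 1) →
      (FreeGroup.lift g w : G ⧸ R) = (FreeGroup.lift g' w : G) := by
    intro g g' hgg'
    rw [QuotientGroup.eq]
    refine hw.inv_lift_mul_lift_mem (A := fun _ => ⊤) (K := fun _ => H 1)
      (fun i => inferInstance) (fun i => hn 1) (fun j hj h hh hhj => ?_) (by simp) (by simp)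
      fun i _ => hgg' i
    refine Subgroup.mem_iSup_of_mem j ?_
    simp only [V, hj, if_true]
    refine lift_mem_verbalOn w fun i => ?_
    by_cases hij : i = j
    · subst hij; simpa using hhj
    · simp [hij, h0]
  have hS : (wordValues w (G ⧸ R)).Finite := by
    have : Finite (G ⧸ H 1) := Subgroup.finite_quotient_of_finiteIndex
    refine (Set.finite_range fun q : ι → G ⧸ H 1 =>
      ((FreeGroup.lift (fun i => (q i).out) w : G) : G ⧸ R)).subset ?_
    rintro _ ⟨g, rfl⟩
    refine ⟨fun i => ((g i).out : G ⧸ H 1), ?_⟩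
    have h2 : FreeGroup.lift g w = ((FreeGroup.lift (fun i => (g i).out) w : G) : G ⧸ R) := by
      rw [← QuotientGroup.mk'_apply R, map_lift_apply]
      congr 2
      ext i
      simp
    dsimp only
    rw [h2]
    refine hmod _ _ fun i => ?_
    rw [← QuotientGroup.eq]
    simp
  have hK : Finite (Subgroup.closure (wordValues w (G ⧸ R))) := by
    refine Subgroup.finite_closure_of_conj_mem hS ?_ ?_
    · rintro _ ⟨g, rfl⟩ x
      exact ⟨fun i => x * g i * x⁻¹, lift_conj g x w⟩
    · rintro _ ⟨g, rfl⟩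
      have h2 := (QuotientGroup.mk' R).isOfFinOrder (hfin' fun i => (g i).out)
      rw [map_lift_apply] at h2
      simpa using h2
  obtain ⟨e, he, heR⟩ := exists_pow_eq_one_iSup hVn hV
  refine ⟨Nat.card (Subgroup.closure (wordValues w (G ⧸ R))) * e, Nat.mul_pos Nat.card_pos he,
    fun x hx => ?_⟩
  rw [pow_mul]
  refine heR _ ?_
  have hle : Subgroup.closure (wordValues w G) ≤
      (Subgroup.closure (wordValues w (G ⧸ R))).comap (QuotientGroup.mk' R) := by
    rw [Subgroup.closure_le]
    rintro _ ⟨g, rfl⟩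
    exact Subgroup.subset_closure
      ⟨fun i => (g i : G ⧸ R), (map_lift_apply (QuotientGroup.mk' R) g w).symm⟩
  rw [← QuotientGroup.eq_one_iff, QuotientGroup.mk_pow]
  exact congrArg Subtype.val (pow_card_eq_one' (x := (⟨_, hle hx⟩ : Subgroup.closure _)))

theorem theorem1p3 {n : ℕ} (w : FreeGroup (Fin n)) (hw : IsMultilinearCommutator w)
    (G : Type*) [Group G] [TopologicalSpace G] [IsTopologicalGroup G] [CompactSpace G]
    [TotallyDisconnectedSpace G]
    (hG : IsVirtuallySoluble G)
    (hfin : ∀ x ∈ wordValues w G, IsOfFinOrder x) :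
    IsLocallyFiniteGroup (verbalSubgroup w G) ∧
      Monoid.ExponentExists (verbalSubgroup w G) := by
  obtain ⟨m, hm, hpow⟩ := hw.exists_pow_eq_one hG hfin
  have hexp : ∀ x : verbalSubgroup w G, x ^ m = 1 := by
    have hcl : IsClosed {x : G | x ^ m = 1} := isClosed_eq (continuous_pow m) continuous_const
    exact fun x => Subtype.ext (closure_minimal hpow hcl x.2)
  refine ⟨fun S hS => ?_, m, hm, hexp⟩
  obtain ⟨H, -, hHf, hHs⟩ := hG
  -- The abstract subgroup generated by `S` is finite, hence closed.
  have hfinite : Finite (Subgroup.closure S) := by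
    have hfg : Group.FG (Subgroup.closure S) :=
      (Group.fg_iff_subgroup_fg _).2 ⟨hS.toFinset, by simp⟩
    let L := (H.subgroupOf (verbalSubgroup w G)).subgroupOf (Subgroup.closure S)
    have hL : Group.IsSolvable L := by
      let f : L →* H :=
        { toFun := fun x => ⟨((x : Subgroup.closure S) : verbalSubgroup w G), x.2⟩
          map_one' := rfl
          map_mul' := fun _ _ => rfl }
      refine Group.isSolvable_of_isSolvable_injective (f := f) fun x y hxy => ?_
      have hxy' := congrArg (fun z : H => (z : G)) hxy
      exact Subtype.ext (Subtype.ext (Subtype.ext hxy'))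
    refine Group.finite_of_fg_of_finiteIndex_isSolvable (fun x => ?_) L
    exact isOfFinOrder_iff_pow_eq_one.2 ⟨m, hm, Subtype.ext (by simpa using hexp x)⟩
  have hclosed : (Subgroup.closure S).topologicalClosure ≤ Subgroup.closure S :=
    Subgroup.topologicalClosure_minimal _ le_rfl
      (Set.toFinite ((Subgroup.closure S : Subgroup _) : Set (verbalSubgroup w G))).isClosed
  exact Finite.of_injective _ (Subgroup.inclusion_injective hclosed)
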